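/- **Setting.** Let $H,n\ge 1$. Consider an episodic MDP with a measurable state space $\mathcal S$, a finite non-empty action set $\mathcal A$, transition kernels $\mathbb P_h(\cdot\mid s,a)$ and deterministic measurable rewards $r_h:\mathcal S\times\mathcal A\to[0,1]$, $h\in[H]$. Let $\mu_1,\dots,\mu_H$ be arbitrary probability measures on $\mathcal S\times\mathcal A$, and let $\nu_h$ be the law of $s'$ when $(s,a)\sim\mu_h$ and $s'\sim\mathbb P_h(\cdot\mid s,a)$. For each $h$ the data consist of $n$ i.i.d. tuples $(s_h^i,a_h^i,r_h^i,s_h'^{\,i},\tilde s_h'^{\,i})$, where $(s_h^i,a_h^i)\sim\mu_h$, $r_h^i=r_h(s_h^i,a_h^i)$ and, given $(s_h^i,a_h^i)$, the states $s_h'^{\,i},\tilde s_h'^{\,i}$ are independent with law $\mathbb P_h(\cdot\mid s_h^i,a_h^i)$. Let $\mathcal F=\mathcal F_1\times\dots\times\mathcal F_H$, where each $\mathcal F_h$ is a class of measurable functions $\mathcal S\times\mathcal A\to[-H,H]$, and put $\mathcal F_{H+1}=\{0\}$, $f_{H+1}=0$. Write $V_q(s)=\max_{a}q(s,a)$, $V_{\mathcal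 F_{h+1}}=\{V_q: q\in\mathcal F_{h+1}\}$, and $(\mathcal T_h^\star q)(s,a)=r_h(s,a)+\mathbb E_{s'\sim\mathbb P_h(\cdot\mid s,a)}V_q(s')$. The Bellman error and the double-sample empirical risk of $f=(f_1,\dots,f_H)\in\mathcal F$ are $$\mathcal E(f)=\frac1H\sum_{h=1}^H\mathbb E_{(s,a)\sim\mu_h}\big(f_h-\mathcal T_h^\star f_{h+1}\big)^2(s,a),\qquad \hat L_{\rm DS}(f)=\frac1{nH}\sum_{h=1}^H\sum_{i=1}^n\ell_h(f_h,f_{h+1})(s_h^i,a_h^i,s_h'^{\,i},\tilde s_h'^{\,i}),$$ $$\ell_h(g,q)(s,a,s',\tilde s')=\big(g(s,a)-r_h(s,a)-V_q(s')\big)^2-\tfrac12\big(V_q(s')-V_q(\tilde s')\big)^2 .$$ For a class $\mathcal G$ of real functions and a law $\rho$, let $$\mathcal R_n^\rho(\mathcal G)=\mathbb E\sup_{g\in\mathcal G}\frac1n\sum_{i=1}^n\sigma_i g(x_i),$$ where $x_1,\dots,x_n$ are i.i.d. with law $\rho$ and $\sigma_1,\dots,\sigma_n$ are independent uniform signs.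 The classes $\mathcal F_h$ (under $\mu_h$), $V_{\mathcal F_{h+1}}$ (under $\nu_h$) and $\{\ell_h(f_h,f_{h+1}): f_h\in\mathcal F_h,\ f_{h+1}\in\mathcal F_{h+1}\}$ (under the law of a data tuple at step $h$) are taken to be measurable classes: for every $m$ and all signs $\sigma\in\{-1,1\}^m$, the supremum over the class $\mathcal G$ of $\sum_{i=1}^m\sigma_i g(x_i)$ is measurable with respect to the completion of $\rho^m$. **Theorem.** There is an absolute constant $c>0$ such that, in every such setting and for every $\delta\in(0,1)$, with probability at least $1-\delta$ every empirical risk minimizer $\hat f\in\arg\min_{f\in\mathcal F}\hat L_{\rm DS}(f)$ satisfies $$\mathcal E(\hat f)\le\inf_{f\in\mathcal F}\mathcal E(f)+cH^2\sqrt{\frac{\log(1/\delta)}{n}}+c\sum_{h=1}^H\Big(\mathcal R_n^{\mu_h}(\mathcal F_h)+\mathcal R_n^{\nu_h}(V_{\mathcal F_{h+1}})\Big).$$ No further assumption is made on the data distributions $\mu_h$, on the MDP, or on how well $\mathcal F$ approximates the optimal value function. -/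

import Mathlib

open MeasureTheory ProbabilityTheory

noncomputable section

/-- An episodic Markov decision process with horizon `H`: a measurable state space `S`, an action
space `A`, transition kernels `ℙ_h(· | s, a)` and deterministic rewards `r_h(s, a) ∈ [0, 1]`.
The step `h ∈ {1, …, H}` is represented by an element of `Fin H`. -/
structure EpisodicMDP (S A : Type*) [MeasurableSpace S] [MeasurableSpace A] (H : ℕ) where
  transition : Fin H → Kernel (S × A) S
  isMarkovKernel_transition : ∀ h, IsMarkovKernel (transition h)
  reward : Fin H → S × A → ℝ
  measurable_reward : ∀ h, Measurable (reward h)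
  reward_mem : ∀ h x, reward h x ∈ Set.Icc (0 : ℝ) 1

/-- The greedy value `V_q(s) = max_a q(s, a)`. -/
def greedyValue {S A : Type*} [Fintype A] [Nonempty A] (q : S × A → ℝ) (s : S) : ℝ :=
  Finset.univ.sup' Finset.univ_nonempty fun a => q (s, a)

/-- A data tuple `((s, a), (s', s̃'))` with two next states. The reward is not stored, because it is
the deterministic function `r_h(s, a)`. -/
abbrev DoubleSample (S A : Type*) := (S × A) × (S × S)

/-- The empirical Rademacher complexity: the average over all sign vectors `σ ∈ {-1, 1}ⁿ` of
`sup_{f ∈ 𝓕} (1/n) ∑ᵢ σᵢ f(xᵢ)`. -/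
def empiricalRademacher {X : Type*} {n : ℕ} (𝓕 : Set (X → ℝ)) (x : Fin n → X) : ℝ :=
  (1 / 2 ^ n : ℝ) * ∑ σ : Fin n → ℤˣ,
    ⨆ f : 𝓕, (1 / n : ℝ) * ∑ i, ((σ i : ℤ) : ℝ) * (f : X → ℝ) (x i)

/-- The population Rademacher complexity `R_n^ρ(𝓕)`: the expectation of the empirical one over
`n` i.i.d. points with law `ρ`. -/
def rademacher {X : Type*} [MeasurableSpace X] (n : ℕ) (ρ : Measure X) (𝓕 : Set (X → ℝ)) : ℝ :=
  ∫ x : Fin n → X, empiricalRademacher 𝓕 x ∂(Measure.pi fun _ => ρ)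

/-- `𝓕` is a `ρ`-measurable class: for every sample size `m` and all signs `σ`, the supremum over
`f ∈ 𝓕` of the signed sum `∑ᵢ σᵢ f(xᵢ)` is a random variable, that is, measurable for the
completion of `ρᵐ`. -/
def IsMeasurableClass {X : Type*} [MeasurableSpace X] (ρ : Measure X) (𝓕 : Set (X → ℝ)) : Prop :=
  ∀ (m : ℕ) (σ : Fin m → ℤˣ),
    AEMeasurable (fun x : Fin m → X => ⨆ f : 𝓕, ∑ i, ((σ i : ℤ) : ℝ) * (f : X → ℝ) (x i))
      (Measure.pi fun _ => ρ)

namespace EpisodicMDP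

variable {S A : Type*} [MeasurableSpace S] [MeasurableSpace A] {H : ℕ}

instance (M : EpisodicMDP S A H) (h : Fin H) : IsMarkovKernel (M.transition h) :=
  M.isMarkovKernel_transition h

/-- The law of the next state `s'` when `(s, a) ∼ μ_h` and `s' ∼ ℙ_h(· | s, a)`. -/
def nextStateLaw (M : EpisodicMDP S A H) (μ : Fin H → Measure (S × A)) (h : Fin H) : Measure S :=
  (μ h).bind (M.transition h)

/-- The law of a double sample at step `h`: `(s, a) ∼ μ_h` and, given `(s, a)`, the two next states
are independent with law `ℙ_h(· | s, a)`. -/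
def doubleSampleLaw (M : EpisodicMDP S A H) (μ : Fin H → Measure (S × A)) (h : Fin H) :
    Measure (DoubleSample S A) :=
  μ h ⊗ₘ (M.transition h ×ₖ M.transition h)

variable [Fintype A] [Nonempty A]

/-- The Bellman optimality operator
`(𝓣_h q)(s, a) = r_h(s, a) + 𝔼[max_{a'} q(s', a') | s, a]`. -/
def bellmanOp (M : EpisodicMDP S A H) (h : Fin H) (q : S × A → ℝ) (x : S × A) : ℝ :=
  M.reward h x + ∫ s', greedyValue q s' ∂(M.transition h x)

/-- The Bellman error `𝓔(f) = (1/H) ∑_h ‖f_h - 𝓣_h f_{h+1}‖²_{μ_h}`. Here `f` has `H + 1`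
components, the last one being `f_{H+1}`. -/
def bellmanError (M : EpisodicMDP S A H) (μ : Fin H → Measure (S × A))
    (f : Fin (H + 1) → S × A → ℝ) : ℝ :=
  (1 / H : ℝ) * ∑ h : Fin H, ∫ x, (f h.castSucc x - M.bellmanOp h (f h.succ) x) ^ 2 ∂(μ h)

/-- The double-sample loss
`(g(s, a) - r_h(s, a) - V_q(s'))² - (1/2) (V_q(s') - V_q(s̃'))²` at step `h`. -/
def doubleSampleLoss (M : EpisodicMDP S A H) (h : Fin H) (g q : S × A → ℝ)
    (z : DoubleSample S A) : ℝ :=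
  (g z.1 - M.reward h z.1 - greedyValue q z.2.1) ^ 2
    - 1 / 2 * (greedyValue q z.2.1 - greedyValue q z.2.2) ^ 2

/-- The empirical risk `L̂_DS(f)`, the average of the double-sample losses over all `n H` tuples
of the data set; `z h i` is the `i`-th tuple collected at step `h`. -/
def empiricalRisk (M : EpisodicMDP S A H) {n : ℕ} (z : Fin H → Fin n → DoubleSample S A)
    (f : Fin (H + 1) → S × A → ℝ) : ℝ :=
  (1 / (n * H) : ℝ) * ∑ h : Fin H, ∑ i : Fin n,
    M.doubleSampleLoss h (f h.castSucc) (f h.succ) (z h i)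

end EpisodicMDP

end

/-! The half squared difference of two conditionally independent next-state values has conditional
mean equal to their variance. Subtracting it from the squared temporal difference removes the
variance bias, so the double-sample loss has mean exactly the squared Bellman error
(`integral_doubleSampleLoss`). Hence `empiricalRisk` is unbiased for `bellmanError`, and the theorem
becomes a uniform deviation bound.

Fix a nonrandom near-minimizer `f₀`. At each step, `exists_hasSubgaussianMGF_deviation` bounds the
deviation of the excess risk relative to `f₀`, uniformly over the loss class, by twice its
Rademacher complexity plus a sub-Gaussian variable. It combines symmetrization with McDiarmid's
inequality on a sample doubled by ghost points, then integrates the ghosts out. The doubling matters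
because the measurability hypothesis concerns signed sums only, not centred ones. Contraction
(`sum_sign_iSup_contraction`) reduces the loss complexity to those of the function and value
classes, at the price of a factor of order `H`, which the average over steps cancels.

Two choices keep the bare `log (1 / δ)`, which vanishes as `δ → 1`. The fluctuation of `f₀` is part
of the same variable as the supremum, so there is one tail event. The steps, which may be mutually
dependent, are combined by convexity of `exp` (`hasSubgaussianMGF_average`) rather than by a union
bound. -/

/-! ### Sign averages and the contraction principle -/

/-- The sum over all sign vectors `σ` of `sup_t ∑ᵢ σᵢ uᵢ(t)`. -/
noncomputable def signSup {T : Type*} {n : ℕ} (u : Fin n → T → ℝ) : ℝ :=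
  ∑ σ : Fin n → ℤˣ, ⨆ t, ∑ i, ((σ i : ℤ) : ℝ) * u i t

theorem abs_sign_mul (s : ℤˣ) (x : ℝ) : |((s : ℤ) : ℝ) * x| = |x| := by
  rcases Int.units_eq_one_or s with rfl | rfl <;> simp

theorem abs_sum_sign_mul_le {ι : Type*} [Fintype ι] (σ : ι → ℤˣ) {u : ι → ℝ} {K : ι → ℝ}
    (hu : ∀ i, |u i| ≤ K i) : |∑ i, ((σ i : ℤ) : ℝ) * u i| ≤ ∑ i, K i := by
  refine (Finset.abs_sum_le_sum_abs _ _).trans (Finset.sum_le_sum fun i _ => ?_)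
  rw [abs_sign_mul]
  exact hu i

theorem bddAbove_range_of_abs_le {T : Type*} {f : T → ℝ} {K : ℝ} (h : ∀ t, |f t| ≤ K) :
    BddAbove (Set.range f) :=
  ⟨K, by rintro _ ⟨t, rfl⟩; exact (abs_le.1 (h t)).2⟩

/-- The contraction principle for a single sign. For a pair `s`, `t`, replace `φ s - φ t` by `|b s -
b t|`; whichever sign the absolute value takes, the result is a value of the right-hand side, with
`s` and `t` possibly exchanged. -/
theorem iSup_add_iSup_sub_le {T : Type*} [Nonempty T] {a φ b : T → ℝ}
    (h : ∀ s t, |φ s - φ t| ≤ |b s - b t|)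
    (h₁ : BddAbove (Set.range fun t => a t + b t)) (h₂ : BddAbove (Set.range fun t => a t - b t)) :
    (⨆ t, (a t + φ t)) + ⨆ t, (a t - φ t) ≤ (⨆ t, (a t + b t)) + ⨆ t, (a t - b t) := by
  rw [← le_sub_iff_add_le]
  refine ciSup_le fun s => ?_
  rw [le_sub_comm]
  refine ciSup_le fun t => ?_
  have hs := le_ciSup h₁ s
  have hs' := le_ciSup h₂ s
  have ht := le_ciSup h₁ t
  have ht' := le_ciSup h₂ t
  have hst := (le_abs_self _).trans (h s t)
  rcases abs_cases (b s - b t) with hb | hb <;> linarith [hb.1]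

theorem sum_sign_pi_succ {n : ℕ} (f : (Fin (n + 1) → ℤˣ) → ℝ) :
    ∑ σ, f σ = ∑ σ : Fin n → ℤˣ, (f (Fin.cons 1 σ) + f (Fin.cons (-1) σ)) := by
  rw [← (Fin.consEquiv fun _ => ℤˣ).sum_comp, Fintype.sum_prod_type_right]
  refine Finset.sum_congr rfl fun σ _ => ?_
  rw [UnitsInt.univ, Finset.sum_pair (by decide)]
  rfl

/-- The contraction principle of Ledoux and Talagrand, with an offset `a`. -/
theorem sum_sign_iSup_contraction {T : Type*} [Nonempty T] {n : ℕ} {φ u : Fin n → T → ℝ} {a : T → ℝ}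
    (h : ∀ i s t, |φ i s - φ i t| ≤ |u i s - u i t|)
    (ha : ∃ K, ∀ t, |a t| ≤ K) (hφ : ∀ i, ∃ K, ∀ t, |φ i t| ≤ K) (hu : ∀ i, ∃ K, ∀ t, |u i t| ≤ K) :
    ∑ σ : Fin n → ℤˣ, ⨆ t, (a t + ∑ i, ((σ i : ℤ) : ℝ) * φ i t) ≤
      ∑ σ : Fin n → ℤˣ, ⨆ t, (a t + ∑ i, ((σ i : ℤ) : ℝ) * u i t) := by
  induction n generalizing a with
  | zero => simp
  | succ n ih =>
    obtain ⟨Ka, ha⟩ := ha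
    choose Ku hKu using hu
    obtain ⟨K₀, hφ₀⟩ := hφ 0
    -- With the first sign frozen, its term joins the offset and the induction hypothesis replaces
    -- all the others. This is why the statement carries an offset.
    have hstep : ∀ s : ℤˣ, ∑ σ : Fin n → ℤˣ,
        ⨆ t, (a t + ∑ i, ((Fin.cons (α := fun _ => ℤˣ) s σ i : ℤ) : ℝ) * φ i t) ≤
        ∑ σ : Fin n → ℤˣ,
          ⨆ t, ((a t + ∑ i, ((σ i : ℤ) : ℝ) * u i.succ t) + ((s : ℤ) : ℝ) * φ 0 t) := by
      intro s
      have := ih (φ := fun i => φ i.succ) (u := fun i => u i.succ)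
        (a := fun t => a t + ((s : ℤ) : ℝ) * φ 0 t) (fun i => h i.succ)
        ⟨Ka + K₀, fun t => (abs_add_le _ _).trans (add_le_add (ha t) (by
          rw [abs_sign_mul]; exact hφ₀ t))⟩ (fun i => hφ i.succ) (fun i => ⟨_, hKu i.succ⟩)
      simpa only [Fin.sum_univ_succ, Fin.cons_zero, Fin.cons_succ, add_assoc,
        add_comm, add_left_comm] using this
    rw [sum_sign_pi_succ, sum_sign_pi_succ, Finset.sum_add_distrib]
    refine (add_le_add (hstep 1) (hstep (-1))).trans ?_
    rw [← Finset.sum_add_distrib]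
    refine Finset.sum_le_sum fun σ _ => ?_
    have hb : ∀ t, |a t + ∑ i, ((σ i : ℤ) : ℝ) * u i.succ t| ≤ Ka + ∑ i : Fin n, Ku i.succ :=
      fun t => (abs_add_le _ _).trans
        (add_le_add (ha t) (abs_sum_sign_mul_le σ fun i => hKu i.succ t))
    have key := iSup_add_iSup_sub_le (a := fun t => a t + ∑ i, ((σ i : ℤ) : ℝ) * u i.succ t)
      (h 0)
      (bddAbove_range_of_abs_le (K := (Ka + ∑ i : Fin n, Ku i.succ) + Ku 0) fun t =>
        (abs_add_le _ _).trans (add_le_add (hb t) (hKu 0 t)))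
      (bddAbove_range_of_abs_le (K := (Ka + ∑ i : Fin n, Ku i.succ) + Ku 0) fun t =>
        (abs_sub _ _).trans (add_le_add (hb t) (hKu 0 t)))
    simpa [Fin.sum_univ_succ, sub_eq_add_neg, add_assoc, add_comm, add_left_comm] using key

section signSup

variable {T T' : Type*} {n : ℕ}

theorem signSup_contraction [Nonempty T] {φ u : Fin n → T → ℝ}
    (h : ∀ i s t, |φ i s - φ i t| ≤ |u i s - u i t|)
    (hφ : ∀ i, ∃ K, ∀ t, |φ i t| ≤ K) (hu : ∀ i, ∃ K, ∀ t, |u i t| ≤ K) :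
    signSup φ ≤ signSup u := by
  simpa [signSup] using sum_sign_iSup_contraction (a := fun _ => 0) h ⟨0, by simp⟩ hφ hu

theorem bddAbove_range_sum_sign_mul {u : Fin n → T → ℝ} (hu : ∀ i, ∃ K, ∀ t, |u i t| ≤ K)
    (σ : Fin n → ℤˣ) : BddAbove (Set.range fun t => ∑ i, ((σ i : ℤ) : ℝ) * u i t) := by
  choose K hK using hu
  exact bddAbove_range_of_abs_le fun t => abs_sum_sign_mul_le σ fun i => hK i t

theorem signSup_add_le [Nonempty T] {u v : Fin n → T → ℝ}
    (hu : ∀ i, ∃ K, ∀ t, |u i t| ≤ K) (hv : ∀ i, ∃ K, ∀ t, |v i t| ≤ K) :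
    signSup (fun i t => u i t + v i t) ≤ signSup u + signSup v := by
  rw [signSup, signSup, signSup, ← Finset.sum_add_distrib]
  refine Finset.sum_le_sum fun σ _ => ciSup_le fun t => ?_
  simp only [mul_add, Finset.sum_add_distrib]
  exact add_le_add (le_ciSup (bddAbove_range_sum_sign_mul hu σ) t)
    (le_ciSup (bddAbove_range_sum_sign_mul hv σ) t)

theorem signSup_neg (u : Fin n → T → ℝ) : signSup (fun i t => -u i t) = signSup u := by
  rw [signSup, signSup, ← Equiv.sum_comp (Equiv.neg (Fin n → ℤˣ))]
  refine Finset.sum_congr rfl fun σ _ => ?_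
  simp

theorem signSup_const_mul {c : ℝ} (hc : 0 ≤ c) (u : Fin n → T → ℝ) :
    signSup (fun i t => c * u i t) = c * signSup u := by
  rw [signSup, signSup, Finset.mul_sum]
  refine Finset.sum_congr rfl fun σ _ => ?_
  rw [Real.mul_iSup_of_nonneg hc]
  simp only [Finset.mul_sum, mul_left_comm]

theorem signSup_comp {p : T → T'} (hp : p.Surjective) (u : Fin n → T' → ℝ) :
    signSup (fun i t => u i (p t)) = signSup u :=
  Finset.sum_congr rfl fun σ _ => hp.iSup_comp (g := fun t => ∑ i, ((σ i : ℤ) : ℝ) * u i t)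

theorem empiricalRademacher_eq_signSup {X : Type*} (𝓕 : Set (X → ℝ)) (x : Fin n → X) :
    empiricalRademacher 𝓕 x =
      (1 / 2 ^ n : ℝ) * (1 / n : ℝ) * signSup fun i (f : 𝓕) => (f : X → ℝ) (x i) := by
  rw [mul_assoc, signSup, Finset.mul_sum, empiricalRademacher]
  congr 1
  refine Finset.sum_congr rfl fun σ _ => ?_
  rw [Real.mul_iSup_of_nonneg (by positivity)]

end signSup

/-! ### Bounds and contraction for the double-sample loss -/

section greedyValue

variable {S A : Type*} [Fintype A] [Nonempty A]

theorem greedyValue_mem_Icc {q : S × A → ℝ} {a b : ℝ} (h : ∀ x, q x ∈ Set.Icc a b) (s : S) :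
    greedyValue q s ∈ Set.Icc a b := by
  obtain ⟨y, -, hy⟩ := Finset.exists_mem_eq_sup' (Finset.univ_nonempty (α := A))
    fun y => q (s, y)
  rw [greedyValue, hy]
  exact h _

theorem measurable_greedyValue [MeasurableSpace S] [MeasurableSpace A] {q : S × A → ℝ}
    (hq : Measurable q) : Measurable (greedyValue q) := by
  have : greedyValue q = Finset.univ.sup' Finset.univ_nonempty fun y s => q (s, y) := by
    ext s
    simp [greedyValue, Finset.sup'_apply]
  rw [this]
  exact Finset.measurable_sup' _ fun y _ => hq.comp (measurable_id.prodMk measurable_const)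

end greedyValue

namespace EpisodicMDP

variable {S A : Type*} [MeasurableSpace S] [MeasurableSpace A] {H : ℕ}
  [Fintype A] [Nonempty A]

theorem measurable_doubleSampleLoss (M : EpisodicMDP S A H) (h : Fin H) {g q : S × A → ℝ}
    (hg : Measurable g) (hq : Measurable q) : Measurable (M.doubleSampleLoss h g q) := by
  have := measurable_greedyValue hq
  have := M.measurable_reward h
  unfold doubleSampleLoss
  fun_prop

theorem abs_temporalDifference_le (M : EpisodicMDP S A H) (h : Fin H) {g q : S × A → ℝ}
    (hg : ∀ x, g x ∈ Set.Icc (-(H : ℝ)) H) (hq : ∀ x, q x ∈ Set.Icc (-(H : ℝ)) H)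
    (x : S × A) (s : S) : |g x - M.reward h x - greedyValue q s| ≤ 3 * H := by
  have hH : (1 : ℝ) ≤ H := by exact_mod_cast h.pos
  have h1 := hg x
  have h2 := M.reward_mem h x
  have h3 := greedyValue_mem_Icc hq s
  rw [abs_le]
  constructor <;> linarith [h1.1, h1.2, h2.1, h2.2, h3.1, h3.2]

theorem abs_doubleSampleLoss_le (M : EpisodicMDP S A H) (h : Fin H) {g q : S × A → ℝ}
    (hg : ∀ x, g x ∈ Set.Icc (-(H : ℝ)) H) (hq : ∀ x, q x ∈ Set.Icc (-(H : ℝ)) H)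
    (z : DoubleSample S A) : |M.doubleSampleLoss h g q z| ≤ 9 * H ^ 2 := by
  have h1 := sq_le_sq' (abs_le.1 (M.abs_temporalDifference_le h hg hq z.1 z.2.1)).1
    (abs_le.1 (M.abs_temporalDifference_le h hg hq z.1 z.2.1)).2
  have h2 := greedyValue_mem_Icc hq z.2.1
  have h3 := greedyValue_mem_Icc hq z.2.2
  have h4 : (greedyValue q z.2.1 - greedyValue q z.2.2) ^ 2 ≤ (2 * H) ^ 2 :=
    sq_le_sq' (by linarith [h2.1, h3.2]) (by linarith [h2.2, h3.1])
  rw [doubleSampleLoss, abs_le]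
  constructor <;> nlinarith [sq_nonneg (greedyValue q z.2.1 - greedyValue q z.2.2),
    sq_nonneg (g z.1 - M.reward h z.1 - greedyValue q z.2.1)]

/-- The loss is a sum of two squares of bounded quantities, each linear in the values of `g` and
`V_q` up to the reward. Contraction and subadditivity give `6 * H` for each of `g` and `V_q(s')`
from the first square, and `2 * H` for each of `V_q(s')` and `V_q(s̃')` from the second, whence `8 =
6 + 2`. -/
theorem empiricalRademacher_doubleSampleLoss_le (M : EpisodicMDP S A H) (h : Fin H) {n : ℕ}
    {F Q : Set (S × A → ℝ)} (hF0 : F.Nonempty) (hQ0 : Q.Nonempty)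
    (hF : ∀ g ∈ F, ∀ x, g x ∈ Set.Icc (-(H : ℝ)) H) (hQ : ∀ q ∈ Q, ∀ x, q x ∈ Set.Icc (-(H : ℝ)) H)
    (z : Fin n → DoubleSample S A) :
    empiricalRademacher (Set.image2 (M.doubleSampleLoss h) F Q) z ≤
      6 * H * empiricalRademacher F (fun i => (z i).1) +
        8 * H * empiricalRademacher (greedyValue '' Q) (fun i => (z i).2.1) +
        2 * H * empiricalRademacher (greedyValue '' Q) (fun i => (z i).2.2) := by
  have := hF0.to_subtype
  have := hQ0.to_subtype
  have hH : (0 : ℝ) ≤ H := Nat.cast_nonneg _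
  let g : Fin n → F × Q → ℝ := fun i t => (t.1 : S × A → ℝ) (z i).1
  let v : Fin n → F × Q → ℝ := fun i t => greedyValue (t.2 : S × A → ℝ) (z i).2.1
  let w : Fin n → F × Q → ℝ := fun i t => greedyValue (t.2 : S × A → ℝ) (z i).2.2
  have hloss : signSup (fun i (f : Set.image2 (M.doubleSampleLoss h) F Q) =>
      (f : DoubleSample S A → ℝ) (z i)) = signSup fun i (t : F × Q) =>
        (g i t - M.reward h (z i).1 - v i t) ^ 2 + -(1 / 2 * (v i t - w i t) ^ 2) := by
    let p : F × Q → Set.image2 (M.doubleSampleLoss h) F Q :=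
      fun t => ⟨_, Set.mem_image2_of_mem t.1.2 t.2.2⟩
    have hp : p.Surjective := by
      rintro ⟨_, a, ha, b, hb, rfl⟩
      exact ⟨(⟨a, ha⟩, ⟨b, hb⟩), rfl⟩
    rw [← signSup_comp hp]
    simp only [p, doubleSampleLoss, g, v, w, sub_eq_add_neg]
  have hg : signSup g = signSup fun i (f : F) => (f : S × A → ℝ) (z i).1 :=
    signSup_comp Prod.fst_surjective fun i (f : F) => (f : S × A → ℝ) (z i).1
  have hvw : ∀ s : Fin n → S, signSup (fun i (t : F × Q) => greedyValue (t.2 : S × A → ℝ) (s i)) =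
      signSup fun i (f : greedyValue '' Q) => (f : S → ℝ) (s i) := by
    intro s
    let p : F × Q → greedyValue '' Q := fun t => ⟨_, Set.mem_image_of_mem _ t.2.2⟩
    have hp : p.Surjective := by
      rintro ⟨_, b, hb, rfl⟩
      exact ⟨(⟨_, hF0.some_mem⟩, ⟨b, hb⟩), rfl⟩
    rw [← signSup_comp hp]
  have bg : ∀ i t, |g i t| ≤ H := fun i t => abs_le.2 (hF _ t.1.2 _)
  have bv : ∀ i t, |v i t| ≤ H := fun i t => abs_le.2 (greedyValue_mem_Icc (hQ _ t.2.2) _)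
  have bw : ∀ i t, |w i t| ≤ H := fun i t => abs_le.2 (greedyValue_mem_Icc (hQ _ t.2.2) _)
  have bd : ∀ i t, |g i t - M.reward h (z i).1 - v i t| ≤ 3 * H := fun i t =>
    M.abs_temporalDifference_le h (hF _ t.1.2) (hQ _ t.2.2) _ _
  have bvw : ∀ i t, |v i t - w i t| ≤ 2 * H := fun i t =>
    (abs_sub _ _).trans (by linarith [bv i t, bw i t])
  have bgv : ∀ i t, |g i t + -v i t| ≤ 2 * H := fun i t =>
    (abs_add_le _ _).trans (by rw [abs_neg]; linarith [bv i t, bg i t])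
  have bφ₁ : ∀ i t, |(g i t - M.reward h (z i).1 - v i t) ^ 2| ≤ (3 * H) ^ 2 := fun i t => by
    rw [abs_pow]; exact pow_le_pow_left₀ (abs_nonneg _) (bd i t) 2
  have bφ₂ : ∀ i t, |(1 : ℝ) / 2 * (v i t - w i t) ^ 2| ≤ 1 / 2 * (2 * (H : ℝ)) ^ 2 := fun i t => by
    rw [abs_mul, abs_pow, abs_of_pos (by norm_num : (0 : ℝ) < 1 / 2)]
    gcongr
    exact bvw i t
  -- Squaring is `6 * H`-Lipschitz on `[-3H, 3H]`. The reward does not depend on `t`, so it cancels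
  -- from the increments.
  have e₁ : signSup (fun i t => (g i t - M.reward h (z i).1 - v i t) ^ 2) ≤
      6 * H * (signSup g + signSup v) := by
    calc _ ≤ signSup fun i t => 6 * H * (g i t + -v i t) := by
          refine signSup_contraction (fun i s t => ?_) (fun i => ⟨_, bφ₁ i⟩)
            (fun i => ⟨6 * H * (2 * H), fun t => ?_⟩)
          · rw [sq_sub_sq, abs_mul, ← mul_sub, abs_mul, abs_of_nonneg (by positivity : 0 ≤ 6 * (H : ℝ))]
            refine mul_le_mul ((abs_add_le _ _).trans (by linarith [bd i s, bd i t])) (le_of_eq ?_)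
              (abs_nonneg _) (by positivity)
            congr 1
            ring
          · rw [abs_mul, abs_of_nonneg (by positivity : 0 ≤ 6 * (H : ℝ))]
            gcongr
            exact bgv i t
      _ ≤ _ := by
          rw [signSup_const_mul (by positivity)]
          gcongr
          refine (signSup_add_le (fun i => ⟨_, bg i⟩)
            (fun i => ⟨H, fun t => by rw [abs_neg]; exact bv i t⟩)).trans_eq ?_
          rw [signSup_neg]
  -- Half the square is `2 * H`-Lipschitz on `[-2H, 2H]`; its minus sign is absorbed by the symmetry
  -- of the signs.
  have e₂ : signSup (fun i t => -(1 / 2 * (v i t - w i t) ^ 2)) ≤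
      2 * H * (signSup v + signSup w) := by
    rw [signSup_neg]
    calc _ ≤ signSup fun i t => 2 * H * (v i t + -w i t) := by
          refine signSup_contraction (fun i s t => ?_) (fun i => ⟨_, bφ₂ i⟩)
            (fun i => ⟨2 * H * (2 * H), fun t => ?_⟩)
          · rw [← mul_sub, sq_sub_sq, abs_mul, abs_mul, ← mul_sub, abs_mul,
              abs_of_nonneg (by positivity : 0 ≤ 2 * (H : ℝ)),
              abs_of_pos (by norm_num : (0 : ℝ) < 1 / 2), ← mul_assoc]
            refine mul_le_mul ?_ (le_of_eq ?_) (abs_nonneg _) (by positivity)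
            · linarith [abs_add_le (v i s - w i s) (v i t - w i t), bvw i s, bvw i t]
            · congr 1
          · rw [abs_mul, abs_of_nonneg (by positivity : 0 ≤ 2 * (H : ℝ)), ← sub_eq_add_neg]
            gcongr
            exact bvw i t
      _ ≤ _ := by
          rw [signSup_const_mul (by positivity)]
          gcongr
          refine (signSup_add_le (fun i => ⟨_, bv i⟩)
            (fun i => ⟨H, fun t => by rw [abs_neg]; exact bw i t⟩)).trans_eq ?_
          rw [signSup_neg]
  have e := signSup_add_le (fun i => ⟨_, bφ₁ i⟩)
    (fun i => ⟨_, fun t => (abs_neg (1 / 2 * (v i t - w i t) ^ 2)).trans_le (bφ₂ i t)⟩)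
  simp only [empiricalRademacher_eq_signSup, hloss]
  rw [← hg, ← hvw, ← hvw]
  have hc : (0 : ℝ) ≤ 1 / 2 ^ n * (1 / n) := by positivity
  calc _ ≤ (1 / 2 ^ n * (1 / n) : ℝ) *
        (6 * H * (signSup g + signSup v) + 2 * H * (signSup v + signSup w)) :=
        mul_le_mul_of_nonneg_left (e.trans (add_le_add e₁ e₂)) hc
    _ = _ := by ring

end EpisodicMDP

/-! ### McDiarmid's inequality under almost-everywhere measurability -/

section McDiarmid

open scoped NNReal

variable {α β Z : Type*} [MeasurableSpace α] [MeasurableSpace β] [MeasurableSpace Z]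

theorem integrable_of_abs_le {μ : Measure α} [IsFiniteMeasure μ] {f : α → ℝ} {K : ℝ}
    (hf : AEMeasurable f μ) (h : ∀ x, |f x| ≤ K) : Integrable f μ :=
  Integrable.of_bound hf.aestronglyMeasurable K (ae_of_all _ h)

theorem integrable_exp_mul_of_abs_le {μ : Measure α} [IsFiniteMeasure μ] {f : α → ℝ} {K : ℝ}
    (hf : AEMeasurable f μ) (h : ∀ x, |f x| ≤ K) (t : ℝ) :
    Integrable (fun x => Real.exp (t * f x)) μ := by
  refine integrable_of_abs_le (K := Real.exp (|t| * K))
    (Real.measurable_exp.comp_aemeasurable (hf.const_mul t)) fun x => ?_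
  rw [Real.abs_exp, Real.exp_le_exp]
  refine (le_abs_self _).trans ?_
  rw [abs_mul]
  exact mul_le_mul_of_nonneg_left (h x) (abs_nonneg t)

theorem abs_integral_le_of_abs_le {μ : Measure α} [IsProbabilityMeasure μ] {f : α → ℝ} {K : ℝ}
    (h : ∀ x, |f x| ≤ K) : |∫ x, f x ∂μ| ≤ K := by
  simpa using norm_integral_le_of_norm_le_const (μ := μ) (f := f) (ae_of_all _ h)

/-- One step of the martingale argument. Split `g - m` into `g - G` and `G - m`, where `G` averages
out the second variable. The first part is sub-Gaussian with `d` conditionally on `x`; the second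
oscillates by at most `c`, so Hoeffding's lemma gives `(c / 2) ^ 2`. Fubini multiplies the two
exponential bounds. -/
theorem hasSubgaussianMGF_sub_integral_prod {μ : Measure α} {ν : Measure β}
    [IsProbabilityMeasure μ] [IsProbabilityMeasure ν] {g : α × β → ℝ} {K : ℝ} {c d : ℝ≥0}
    (hg : AEMeasurable g (μ.prod ν)) (hK : ∀ p, |g p| ≤ K)
    (hd : ∀ x, AEMeasurable (fun y => g (x, y)) ν →
      HasSubgaussianMGF (fun y => g (x, y) - ∫ y, g (x, y) ∂ν) d ν)
    (hc : ∀ x x' y, |g (x, y) - g (x', y)| ≤ c) :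
    HasSubgaussianMGF (fun p => g p - ∫ p, g p ∂μ.prod ν) (d + (c / 2) ^ 2) (μ.prod ν) := by
  have hint := integrable_of_abs_le hg hK
  set m := ∫ p, g p ∂μ.prod ν with hm
  set G : α → ℝ := fun x => ∫ y, g (x, y) ∂ν with hG
  have hmG : m = ∫ x, G x ∂μ := integral_prod g hint
  have hGm : AEMeasurable G μ := hint.integral_prod_left.aemeasurable
  have hGK : ∀ x, |G x| ≤ K := fun x => abs_integral_le_of_abs_le fun y => hK _
  have hsec : ∀ᵐ x ∂μ, AEMeasurable (fun y => g (x, y)) ν := by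
    filter_upwards [hg.aestronglyMeasurable.prodMk_left] with x hx using hx.aemeasurable
  have hosc : ∀ x x', AEMeasurable (fun y => g (x, y)) ν → AEMeasurable (fun y => g (x', y)) ν →
      G x - c ≤ G x' := by
    intro x x' hx hx'
    have hi := integrable_of_abs_le hx fun y => hK _
    have hi' := integrable_of_abs_le hx' fun y => hK _
    have : ∫ y, g (x, y) ∂ν ≤ ∫ y, (g (x', y) + c) ∂ν :=
      integral_mono hi (hi'.add (integrable_const _)) fun y => by
        have := (abs_le.1 (hc x x' y)).2
        simp only
        linarith
    rw [integral_add hi' (integrable_const _)] at this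
    simp only [integral_const, probReal_univ, one_smul] at this
    simp only [hG]
    linarith
  -- Where the section is not measurable, the integral `G x` is the default `0` and escapes the
  -- oscillation bound. The interval for Hoeffding's lemma is therefore built from the good points
  -- alone, which are almost all points.
  set N : Set ℝ := G '' {x | AEMeasurable (fun y => g (x, y)) ν}
  have hN : BddBelow N := ⟨-K, by rintro _ ⟨x, -, rfl⟩; exact (abs_le.1 (hGK x)).1⟩
  have hrange : ∀ᵐ x ∂μ, G x ∈ Set.Icc (sInf N) (sInf N + c) := by
    filter_upwards [hsec] with x hx
    refine ⟨csInf_le hN ⟨x, hx, rfl⟩, ?_⟩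
    rw [← sub_le_iff_le_add]
    refine le_csInf ⟨_, x, hx, rfl⟩ ?_
    rintro _ ⟨x', hx', rfl⟩
    exact hosc x x' hx hx'
  have hGsub := hasSubgaussianMGF_of_mem_Icc hGm hrange
  rw [add_sub_cancel_left, NNReal.nnnorm_eq, ← hmG] at hGsub
  have hexp : ∀ t, Integrable (fun p => Real.exp (t * (g p - m))) (μ.prod ν) := fun t =>
    integrable_exp_mul_of_abs_le (K := K + |m|) (hg.sub_const m)
      (fun p => (abs_sub _ _).trans (by linarith [hK p])) t
  refine ⟨hexp, fun t => ?_⟩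
  rw [mgf, integral_prod _ (hexp t)]
  calc ∫ x, ∫ y, Real.exp (t * (g (x, y) - m)) ∂ν ∂μ
      ≤ ∫ x, Real.exp (t * (G x - m)) * Real.exp (d * t ^ 2 / 2) ∂μ := by
        refine integral_mono_ae (hexp t).integral_prod_left
          ((hGsub.integrable_exp_mul t).mul_const _) ?_
        filter_upwards [hsec] with x hx
        have heq : ∀ y, Real.exp (t * (g (x, y) - m)) =
            Real.exp (t * (G x - m)) * Real.exp (t * (g (x, y) - G x)) := fun y => by
          rw [← Real.exp_add]
          ring_nf
        simp only [heq]
        rw [integral_const_mul]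
        exact mul_le_mul_of_nonneg_left ((hd x hx).mgf_le t) (Real.exp_nonneg _)
    _ ≤ Real.exp (((c / 2) ^ 2 : ℝ≥0) * t ^ 2 / 2) * Real.exp (d * t ^ 2 / 2) := by
        rw [integral_mul_const]
        exact mul_le_mul_of_nonneg_right (hGsub.mgf_le t) (Real.exp_nonneg _)
    _ = _ := by
        rw [← Real.exp_add, NNReal.coe_add]
        ring_nf

theorem hasSubgaussianMGF_of_boundedDifferences_fin (ρ : Measure Z) [IsProbabilityMeasure ρ]
    (c : ℝ≥0) {n : ℕ} {g : (Fin n → Z) → ℝ} {K : ℝ}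
    (hg : AEMeasurable g (Measure.pi fun _ => ρ)) (hK : ∀ y, |g y| ≤ K)
    (hc : ∀ y i z, |g (Function.update y i z) - g y| ≤ c) :
    HasSubgaussianMGF (fun y => g y - ∫ y, g y ∂(Measure.pi fun _ => ρ)) (n * (c / 2) ^ 2)
      (Measure.pi fun _ => ρ) := by
  induction n with
  | zero =>
    have hconst : g = fun _ => g Fin.elim0 := by
      ext y
      rw [Subsingleton.elim y]
    rw [hconst]
    simp
  | succ n ih =>
    have mp := measurePreserving_piFinSuccAbove (fun _ : Fin (n + 1) => ρ) 0
    set e := MeasurableEquiv.piFinSuccAbove (fun _ : Fin (n + 1) => Z) 0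
    have hcons : ∀ p, e.symm p = Fin.cons p.1 p.2 := fun p => by
      rw [MeasurableEquiv.symm_apply_eq]
      simp [e, MeasurableEquiv.piFinSuccAbove, Fin.insertNthEquiv]
    have hge : AEMeasurable (fun p => g (e.symm p)) (ρ.prod (Measure.pi fun _ => ρ)) :=
      hg.comp_quasiMeasurePreserving (mp.symm e).quasiMeasurePreserving
    have key := hasSubgaussianMGF_sub_integral_prod (c := c) (d := n * (c / 2) ^ 2) hge
      (fun p => hK _)
      (fun x hx => ih hx (fun y => hK _) fun y i z => by
        simpa [hcons, Fin.cons_update] using hc (Fin.cons x y) i.succ z)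
      (fun x x' y => by
        simpa [hcons, Fin.update_cons_zero] using hc (Fin.cons x' y) 0 x)
    rw [← mp.integral_comp' (g := fun p => g (e.symm p))] at key
    have := HasSubgaussianMGF.of_map mp.measurable.aemeasurable (mp.map_eq.symm ▸ key)
    simpa [Function.comp_def, add_mul] using this

theorem measurePreserving_comp_equiv {ι ι' : Type*} [Fintype ι] [Fintype ι'] (ρ : Measure Z)
    [SigmaFinite ρ] (e : ι' ≃ ι) :
    MeasurePreserving (fun y : ι → Z => y ∘ e) (Measure.pi fun _ => ρ) (Measure.pi fun _ => ρ) :=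
  measurePreserving_arrowCongr' (fun _ : ι => ρ) (fun _ : ι' => ρ) e.symm (MeasurableEquiv.refl Z)
    fun _ => .id ρ

/-- McDiarmid's inequality in sub-Gaussian form: a function of independent variables with bounded
differences is sub-Gaussian around its mean. -/
theorem hasSubgaussianMGF_of_boundedDifferences {ι : Type*} [Fintype ι] [DecidableEq ι]
    (ρ : Measure Z) [IsProbabilityMeasure ρ] (c : ℝ≥0) {g : (ι → Z) → ℝ} {K : ℝ}
    (hg : AEMeasurable g (Measure.pi fun _ => ρ)) (hK : ∀ y, |g y| ≤ K)
    (hc : ∀ y i z, |g (Function.update y i z) - g y| ≤ c) :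
    HasSubgaussianMGF (fun y => g y - ∫ y, g y ∂(Measure.pi fun _ => ρ))
      (Fintype.card ι * (c / 2) ^ 2) (Measure.pi fun _ => ρ) := by
  let e := Fintype.equivFin ι
  have mp := measurePreserving_comp_equiv ρ e
  have mp' := measurePreserving_comp_equiv ρ e.symm
  have h := hasSubgaussianMGF_of_boundedDifferences_fin ρ c (g := fun y => g (y ∘ e))
    (hg.comp_quasiMeasurePreserving mp.quasiMeasurePreserving) (fun y => hK _)
    (fun y i z => by
      rw [show Function.update y i z ∘ e = Function.update (y ∘ e) (e.symm i) z by
        rw [Function.update_comp_equiv]]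
      exact hc _ _ _)
  have hint : ∫ y, g (y ∘ e) ∂(Measure.pi fun _ => ρ) = ∫ y, g y ∂(Measure.pi fun _ => ρ) := by
    conv_rhs => rw [← mp.map_eq]
    rw [integral_map mp.aemeasurable (mp.map_eq.symm ▸ hg.aestronglyMeasurable)]
  rw [hint] at h
  have := HasSubgaussianMGF.of_map mp'.aemeasurable (mp'.map_eq.symm ▸ h)
  simpa [Function.comp_def] using this

end McDiarmid

/-! ### Symmetrization and uniform deviations -/

section Symmetrization

open scoped NNReal

variable {α β Z : Type*} [MeasurableSpace α] [MeasurableSpace β] [MeasurableSpace Z]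

/-- The supremum over `f ∈ 𝓖` of the signed sum `∑ᵢ σᵢ f(yᵢ)`. -/
noncomputable def signedSup {ι X : Type*} [Fintype ι] (𝓖 : Set (X → ℝ)) (σ : ι → ℤˣ) (y : ι → X) : ℝ :=
  ⨆ f : 𝓖, ∑ i, ((σ i : ℤ) : ℝ) * (f : X → ℝ) (y i)

section signedSup

variable {X ι ι' : Type*} [Fintype ι] [Fintype ι'] {𝓖 : Set (X → ℝ)} {K : ℝ}

theorem sum_sign_mul_le_signedSup (hK : ∀ f ∈ 𝓖, ∀ x, |f x| ≤ K) (σ : ι → ℤˣ) (y : ι → X)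
    {f : X → ℝ} (hf : f ∈ 𝓖) : ∑ i, ((σ i : ℤ) : ℝ) * f (y i) ≤ signedSup 𝓖 σ y :=
  le_ciSup (f := fun f : 𝓖 => ∑ i, ((σ i : ℤ) : ℝ) * (f : X → ℝ) (y i))
    (bddAbove_range_of_abs_le fun f => abs_sum_sign_mul_le σ fun i => hK f f.2 (y i)) ⟨f, hf⟩

theorem signedSup_le (h𝓖 : 𝓖.Nonempty) {σ : ι → ℤˣ} {y : ι → X} {b : ℝ}
    (h : ∀ f ∈ 𝓖, ∑ i, ((σ i : ℤ) : ℝ) * f (y i) ≤ b) : signedSup 𝓖 σ y ≤ b :=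
  have := h𝓖.to_subtype
  ciSup_le fun f => h f f.2

theorem abs_signedSup_le (h𝓖 : 𝓖.Nonempty) (hK : ∀ f ∈ 𝓖, ∀ x, |f x| ≤ K) (σ : ι → ℤˣ)
    (y : ι → X) : |signedSup 𝓖 σ y| ≤ Fintype.card ι * K := by
  have h : ∀ f ∈ 𝓖, |∑ i, ((σ i : ℤ) : ℝ) * f (y i)| ≤ Fintype.card ι * K := fun f hf =>
    (abs_sum_sign_mul_le σ fun i => hK f hf (y i)).trans_eq (by simp)
  obtain ⟨f, hf⟩ := h𝓖
  exact abs_le.2 ⟨(abs_le.1 (h f hf)).1.trans (sum_sign_mul_le_signedSup hK σ y hf),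
    signedSup_le ⟨f, hf⟩ fun g hg => (abs_le.1 (h g hg)).2⟩

theorem abs_sum_sign_mul_update_sub_le [DecidableEq ι] (σ : ι → ℤˣ) {f : X → ℝ}
    (hK : ∀ x, |f x| ≤ K) (y : ι → X) (i : ι) (z : X) :
    |∑ j, ((σ j : ℤ) : ℝ) * f (Function.update y i z j) - ∑ j, ((σ j : ℤ) : ℝ) * f (y j)| ≤
      2 * K := by
  rw [← Finset.sum_sub_distrib, Finset.sum_eq_single i]
  · rw [Function.update_self, ← mul_sub, abs_sign_mul]
    exact (abs_sub _ _).trans (by linarith [hK z, hK (y i)])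
  · intro j _ hj
    simp [hj]
  · simp

theorem signedSup_update_le [DecidableEq ι] (h𝓖 : 𝓖.Nonempty) (hK : ∀ f ∈ 𝓖, ∀ x, |f x| ≤ K)
    (σ : ι → ℤˣ) (y : ι → X) (i : ι) (z : X) :
    signedSup 𝓖 σ (Function.update y i z) ≤ signedSup 𝓖 σ y + 2 * K :=
  signedSup_le h𝓖 fun f hf => by
    linarith [(abs_le.1 (abs_sum_sign_mul_update_sub_le σ (hK f hf) y i z)).2,
      sum_sign_mul_le_signedSup hK σ y hf]

theorem abs_signedSup_update_sub_le [DecidableEq ι] (h𝓖 : 𝓖.Nonempty)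
    (hK : ∀ f ∈ 𝓖, ∀ x, |f x| ≤ K) (σ : ι → ℤˣ) (y : ι → X) (i : ι) (z : X) :
    |signedSup 𝓖 σ (Function.update y i z) - signedSup 𝓖 σ y| ≤ 2 * K := by
  have h := signedSup_update_le h𝓖 hK σ (Function.update y i z) i (y i)
  rw [Function.update_idem, Function.update_eq_self] at h
  rw [abs_le]
  constructor <;> linarith [signedSup_update_le h𝓖 hK σ y i z]

theorem signedSup_comp_equiv (e : ι' ≃ ι) (σ : ι' → ℤˣ) (y : ι → X) :
    signedSup 𝓖 σ (y ∘ e) = signedSup 𝓖 (σ ∘ e.symm) y := by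
  refine iSup_congr fun f => ?_
  rw [← e.sum_comp]
  simp

theorem signedSup_sum_le (h𝓖 : 𝓖.Nonempty) (hK : ∀ f ∈ 𝓖, ∀ x, |f x| ≤ K) (σ : ι ⊕ ι' → ℤˣ)
    (y : ι ⊕ ι' → X) : signedSup 𝓖 σ y ≤
      signedSup 𝓖 (σ ∘ Sum.inl) (y ∘ Sum.inl) + signedSup 𝓖 (σ ∘ Sum.inr) (y ∘ Sum.inr) :=
  signedSup_le h𝓖 fun f hf => by
    rw [Fintype.sum_sum_type]
    exact add_le_add (sum_sign_mul_le_signedSup hK (σ ∘ Sum.inl) (y ∘ Sum.inl) hf)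
      (sum_sign_mul_le_signedSup hK (σ ∘ Sum.inr) (y ∘ Sum.inr) hf)

end signedSup

variable {ρ : Measure Z} [IsProbabilityMeasure ρ] {𝓖 : Set (Z → ℝ)} {K : ℝ} {n : ℕ}

theorem IsMeasurableClass.aemeasurable_signedSup {ι : Type*} [Fintype ι]
    (h : IsMeasurableClass ρ 𝓖) (σ : ι → ℤˣ) :
    AEMeasurable (signedSup 𝓖 σ) (Measure.pi fun _ => ρ) := by
  let e := Fintype.equivFin ι
  have := (h _ (σ ∘ e.symm)).comp_quasiMeasurePreserving
    (measurePreserving_comp_equiv ρ e.symm).quasiMeasurePreserving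
  refine this.congr (ae_of_all _ fun y => ?_)
  exact (signedSup_comp_equiv e.symm (σ ∘ e.symm) y).trans (by simp [Function.comp_assoc])

theorem IsMeasurableClass.integrable_signedSup {ι : Type*} [Fintype ι]
    (h : IsMeasurableClass ρ 𝓖) (h𝓖 : 𝓖.Nonempty) (hK : ∀ f ∈ 𝓖, ∀ x, |f x| ≤ K) (σ : ι → ℤˣ) :
    Integrable (signedSup 𝓖 σ) (Measure.pi fun _ => ρ) :=
  integrable_of_abs_le (h.aemeasurable_signedSup σ) (abs_signedSup_le h𝓖 hK σ)

theorem empiricalRademacher_eq_sum_signedSup {X : Type*} {𝓖 : Set (X → ℝ)} (x : Fin n → X) :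
    empiricalRademacher 𝓖 x =
    (1 / 2 ^ n : ℝ) * (1 / n : ℝ) * ∑ σ : Fin n → ℤˣ, signedSup 𝓖 σ x :=
  empiricalRademacher_eq_signSup 𝓖 x

theorem IsMeasurableClass.integrable_empiricalRademacher
    (h : IsMeasurableClass ρ 𝓖) (h𝓖 : 𝓖.Nonempty) (hK : ∀ f ∈ 𝓖, ∀ x, |f x| ≤ K) :
    Integrable (fun x : Fin n → Z => empiricalRademacher 𝓖 x) (Measure.pi fun _ => ρ) := by
  simp only [empiricalRademacher_eq_sum_signedSup]
  exact (integrable_finsetSum _ fun σ _ => h.integrable_signedSup h𝓖 hK σ).const_mul _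

theorem IsMeasurableClass.rademacher_eq
    (h : IsMeasurableClass ρ 𝓖) (h𝓖 : 𝓖.Nonempty) (hK : ∀ f ∈ 𝓖, ∀ x, |f x| ≤ K) :
    rademacher n ρ 𝓖 = (1 / 2 ^ n : ℝ) * (1 / n : ℝ) *
      ∑ σ : Fin n → ℤˣ, ∫ x, signedSup 𝓖 σ x ∂(Measure.pi fun _ => ρ) := by
  rw [rademacher, ← integral_finsetSum _ fun σ _ => h.integrable_signedSup h𝓖 hK σ,
    ← integral_const_mul]
  simp only [empiricalRademacher_eq_sum_signedSup]

theorem measurePreserving_sumElim {ι ι' : Type*} [Fintype ι] [Fintype ι'] (ρ : Measure Z)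
    [SigmaFinite ρ] :
    MeasurePreserving (fun p : (ι → Z) × (ι' → Z) => Sum.elim p.1 p.2)
      ((Measure.pi fun _ => ρ).prod (Measure.pi fun _ => ρ)) (Measure.pi fun _ => ρ) := by
  convert measurePreserving_sumPiEquivProdPi_symm (X := fun _ : ι ⊕ ι' => Z) fun _ => ρ using 1
  ext p (i | i) <;> rfl

theorem measurePreserving_comp_inl {ι ι' : Type*} [Fintype ι] [Fintype ι'] (ρ : Measure Z)
    [IsProbabilityMeasure ρ] :
    MeasurePreserving (fun y : ι ⊕ ι' → Z => y ∘ Sum.inl) (Measure.pi fun _ => ρ)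
      (Measure.pi fun _ => ρ) :=
  measurePreserving_fst.comp
    (measurePreserving_sumPiEquivProdPi (X := fun _ : ι ⊕ ι' => Z) fun _ => ρ)

theorem measurePreserving_comp_inr {ι ι' : Type*} [Fintype ι] [Fintype ι'] (ρ : Measure Z)
    [IsProbabilityMeasure ρ] :
    MeasurePreserving (fun y : ι ⊕ ι' → Z => y ∘ Sum.inr) (Measure.pi fun _ => ρ)
      (Measure.pi fun _ => ρ) :=
  measurePreserving_snd.comp
    (measurePreserving_sumPiEquivProdPi (X := fun _ : ι ⊕ ι' => Z) fun _ => ρ)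

theorem _root_.MeasureTheory.MeasurePreserving.integral_comp_of_aemeasurable {μ : Measure α}
    {ν : Measure β} {p : α → β} (hp : MeasurePreserving p μ ν) {f : β → ℝ} (hf : AEMeasurable f ν) :
    ∫ x, f (p x) ∂μ = ∫ y, f y ∂ν := by
  rw [← hp.map_eq, integral_map hp.aemeasurable (hp.map_eq.symm ▸ hf.aestronglyMeasurable)]

theorem _root_.MeasureTheory.MeasurePreserving.integrable_comp_fun {μ : Measure α} {ν : Measure β}
    {p : α → β} (hp : MeasurePreserving p μ ν) {f : β → ℝ} (hf : Integrable f ν) :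
    Integrable (fun x => f (p x)) μ :=
  hp.integrable_comp_of_integrable hf

/-- The signs of the ghost-sample difference `∑ᵢ f(x'ᵢ) - ∑ᵢ f(xᵢ)`. -/
def ghostSign (n : ℕ) : Fin n ⊕ Fin n → ℤˣ := Sum.elim (fun _ => -1) fun _ => 1

/-- The permutation exchanging the `i`-th point and its ghost whenever `σᵢ = -1`. -/
def ghostSwap (σ : Fin n → ℤˣ) : Fin n ⊕ Fin n ≃ Fin n ⊕ Fin n :=
  Function.Involutive.toPerm
    (Sum.elim (fun i => if σ i = 1 then .inl i else .inr i)
      fun i => if σ i = 1 then .inr i else .inl i)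
    (by rintro (i | i) <;> by_cases h : σ i = 1 <;> simp [h])

theorem ghostSign_comp_ghostSwap (σ : Fin n → ℤˣ) :
    ghostSign n ∘ (ghostSwap σ).symm = Sum.elim (-σ) σ := by
  ext (i | i) <;> rcases Int.units_eq_one_or (σ i) with h | h <;>
    simp [ghostSign, ghostSwap, Function.Involutive.toPerm, h]

/-- Symmetrization. -/
theorem integral_signedSup_ghostSign_le
    (h : IsMeasurableClass ρ 𝓖) (h𝓖 : 𝓖.Nonempty) (hK : ∀ f ∈ 𝓖, ∀ x, |f x| ≤ K) :
    (1 / n : ℝ) * ∫ y, signedSup 𝓖 (ghostSign n) y ∂(Measure.pi fun _ => ρ) ≤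
      2 * rademacher n ρ 𝓖 := by
  -- The doubled sample is exchangeable, so applying `ghostSwap σ` leaves the integral unchanged and
  -- turns the signs into `(-σ, σ)`. The supremum then splits over the two halves; averaging over
  -- `σ` gives two copies of the complexity.
  have key : ∀ σ : Fin n → ℤˣ, ∫ y, signedSup 𝓖 (ghostSign n) y ∂(Measure.pi fun _ => ρ) ≤
      ∫ x, signedSup 𝓖 (-σ) x ∂(Measure.pi fun _ => ρ) +
        ∫ x, signedSup 𝓖 σ x ∂(Measure.pi fun _ => ρ) := by
    intro σ
    have hl := measurePreserving_comp_inl (ι := Fin n) (ι' := Fin n) ρ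
    have hr := measurePreserving_comp_inr (ι := Fin n) (ι' := Fin n) ρ
    rw [← (measurePreserving_comp_equiv ρ (ghostSwap σ)).integral_comp_of_aemeasurable
        (h.aemeasurable_signedSup _),
      ← hl.integral_comp_of_aemeasurable (h.aemeasurable_signedSup _),
      ← hr.integral_comp_of_aemeasurable (h.aemeasurable_signedSup _)]
    have il := hl.integrable_comp_fun (h.integrable_signedSup h𝓖 hK (-σ))
    have ir := hr.integrable_comp_fun (h.integrable_signedSup h𝓖 hK σ)
    simp only [signedSup_comp_equiv, ghostSign_comp_ghostSwap]
    rw [← integral_add il ir]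
    exact integral_mono (h.integrable_signedSup h𝓖 hK _) (il.add ir) fun y =>
      signedSup_sum_le h𝓖 hK (Sum.elim (-σ) σ) y
  have hsum := Finset.sum_le_sum fun σ (_ : σ ∈ (Finset.univ : Finset (Fin n → ℤˣ))) => key σ
  have hneg : ∑ σ : Fin n → ℤˣ, ∫ x, signedSup 𝓖 (-σ) x ∂(Measure.pi fun _ => ρ) =
      ∑ σ : Fin n → ℤˣ, ∫ x, signedSup 𝓖 σ x ∂(Measure.pi fun _ => ρ) :=
    Equiv.sum_comp (Equiv.neg (Fin n → ℤˣ)) fun σ =>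
      ∫ x, signedSup 𝓖 σ x ∂(Measure.pi fun _ => ρ)
  have hcard : ((Fintype.card (Fin n → ℤˣ) : ℕ) : ℝ) = 2 ^ n := by simp
  rw [Finset.sum_add_distrib, hneg, Finset.sum_const, Finset.card_univ, nsmul_eq_mul, hcard] at hsum
  rw [h.rademacher_eq h𝓖 hK]
  have h2 : (0 : ℝ) < 2 ^ n := by positivity
  calc _ = (1 / 2 ^ n : ℝ) * (1 / n : ℝ) *
        (2 ^ n * ∫ y, signedSup 𝓖 (ghostSign n) y ∂(Measure.pi fun _ => ρ)) := by
        field_simp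
    _ ≤ _ := mul_le_mul_of_nonneg_left hsum (by positivity)
    _ = _ := by ring

/-- By Jensen's inequality for `exp`, averaging over one variable cannot increase the moment
generating function. -/
theorem _root_.ProbabilityTheory.HasSubgaussianMGF.integral_prod_right {μ : Measure α} {ν : Measure β}
    [IsProbabilityMeasure μ] [IsProbabilityMeasure ν] {g : α × β → ℝ} {c : ℝ≥0}
    (hg : HasSubgaussianMGF g c (μ.prod ν)) (hK : ∀ p, |g p| ≤ K) :
    HasSubgaussianMGF (fun x => ∫ y, g (x, y) ∂ν) c μ := by
  have hi (t : ℝ) : Integrable (fun x => Real.exp (t * ∫ y, g (x, y) ∂ν)) μ :=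
    integrable_exp_mul_of_abs_le hg.integrable.integral_prod_left.aemeasurable
      (fun x => abs_integral_le_of_abs_le fun y => hK _) t
  refine ⟨hi, fun t => (integral_mono_ae (hi t)
    (hg.integrable_exp_mul t).integral_prod_left ?_).trans
      ((MeasureTheory.integral_prod _ (hg.integrable_exp_mul t)).symm.trans_le (hg.mgf_le t))⟩
  filter_upwards [hg.aestronglyMeasurable.prodMk_left] with x hx
  have hint := integrable_of_abs_le hx.aemeasurable fun y => hK (x, y)
  have := convexOn_exp.map_integral_le (μ := ν) (f := fun y => t * g (x, y))
    Real.continuous_exp.continuousOn isClosed_univ (by simp) (hint.const_mul t)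
    (integrable_exp_mul_of_abs_le hx.aemeasurable (fun y => hK (x, y)) t)
  rwa [integral_const_mul] at this

theorem integral_sample_average {f : Z → ℝ} (hn : n ≠ 0) (hf : Integrable f ρ) :
    ∫ x : Fin n → Z, (1 / n : ℝ) * ∑ i, f (x i) ∂(Measure.pi fun _ => ρ) = ∫ z, f z ∂ρ := by
  have mp (i : Fin n) := measurePreserving_eval (fun _ : Fin n => ρ) i
  rw [integral_const_mul, integral_finsetSum _ fun i _ => (mp i).integrable_comp_fun hf]
  have (i : Fin n) : ∫ x : Fin n → Z, f (x i) ∂(Measure.pi fun _ => ρ) = ∫ z, f z ∂ρ :=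
    (mp i).integral_comp_of_aemeasurable hf.aemeasurable
  simp only [this, Finset.sum_const, Finset.card_univ, Fintype.card_fin, nsmul_eq_mul]
  field_simp

/-- The one-sided uniform deviation of the empirical excess risk over a class is bounded by twice
the Rademacher complexity plus a sub-Gaussian variable. -/
theorem IsMeasurableClass.exists_hasSubgaussianMGF_deviation {K : ℝ≥0} (hn : n ≠ 0)
    (h : IsMeasurableClass ρ 𝓖) (hm : ∀ f ∈ 𝓖, Measurable f) (hK : ∀ f ∈ 𝓖, ∀ x, |f x| ≤ K)
    {g : Z → ℝ} (hg : g ∈ 𝓖) :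
    ∃ X : (Fin n → Z) → ℝ, HasSubgaussianMGF X (8 * K ^ 2 / n) (Measure.pi fun _ => ρ) ∧
      ∀ᵐ x ∂(Measure.pi fun _ => ρ), ∀ f ∈ 𝓖,
        (∫ z, f z ∂ρ - (1 / n : ℝ) * ∑ i, f (x i)) +
          ((1 / n : ℝ) * ∑ i, g (x i) - ∫ z, g z ∂ρ) ≤ X x + 2 * rademacher n ρ 𝓖 := by
  have h𝓖 : 𝓖.Nonempty := ⟨g, hg⟩
  have hn' : (0 : ℝ) < n := by positivity
  let τ := ghostSign n
  let Γ : (Fin n ⊕ Fin n → Z) → ℝ := fun y => ∑ j, ((τ j : ℤ) : ℝ) * g (y j)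
  -- Subtracting the mean-zero `Γ` inserts the reference `g` without changing the expectation.
  -- Changing one point moves each of the two terms by at most `2 * K`, which gives the increment `4
  -- * K / n`.
  let Ξ : (Fin n ⊕ Fin n → Z) → ℝ := fun y => (1 / n : ℝ) * (signedSup 𝓖 τ y - Γ y)
  have hgm := hm g hg
  have hgi : Integrable g ρ := integrable_of_abs_le hgm.aemeasurable (hK g hg)
  have hΓm : Measurable Γ := by fun_prop
  have hΓK : ∀ y, |Γ y| ≤ Fintype.card (Fin n ⊕ Fin n) * K := fun y =>
    (abs_sum_sign_mul_le τ fun j => hK g hg (y j)).trans_eq (by simp)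
  have hΓi : Integrable Γ (Measure.pi fun _ => ρ) := integrable_of_abs_le hΓm.aemeasurable hΓK
  have hΓ0 : ∫ y, Γ y ∂(Measure.pi fun _ => ρ) = 0 := by
    have mp (j : Fin n ⊕ Fin n) := measurePreserving_eval (fun _ : Fin n ⊕ Fin n => ρ) j
    have hj (j : Fin n ⊕ Fin n) : ∫ y : Fin n ⊕ Fin n → Z, g (y j) ∂(Measure.pi fun _ => ρ) =
        ∫ z, g z ∂ρ := (mp j).integral_comp_of_aemeasurable hgm.aemeasurable
    simp only [Γ]
    rw [integral_finsetSum _ fun j _ => ((mp j).integrable_comp_fun hgi).const_mul _]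
    simp [integral_const_mul, hj, τ, ghostSign]
  have hΞm : AEMeasurable Ξ (Measure.pi fun _ => ρ) :=
    ((h.aemeasurable_signedSup τ).sub hΓm.aemeasurable).const_mul _
  have hΞK : ∀ y, |Ξ y| ≤ 4 * K := fun y => by
    have h1 := abs_signedSup_le h𝓖 hK τ y
    have h2 := hΓK y
    rw [Fintype.card_sum, Fintype.card_fin, Nat.cast_add] at h1 h2
    rw [abs_mul, abs_of_pos (by positivity : (0 : ℝ) < 1 / n), one_div_mul_eq_div, div_le_iff₀ hn']
    exact (abs_sub _ _).trans (by linarith)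
  have hΞd : ∀ y j z, |Ξ (Function.update y j z) - Ξ y| ≤ (4 * K / n : ℝ≥0) := fun y j z => by
    rw [← mul_sub, abs_mul, abs_of_pos (by positivity : (0 : ℝ) < 1 / n), one_div_mul_eq_div]
    push_cast
    gcongr
    rw [sub_sub_sub_comm]
    exact (abs_sub _ _).trans (by
      linarith [abs_signedSup_update_sub_le h𝓖 hK τ y j z,
        abs_sum_sign_mul_update_sub_le τ (hK g hg) y j z])
  have hΞi : ∫ y, Ξ y ∂(Measure.pi fun _ => ρ) ≤ 2 * rademacher n ρ 𝓖 := by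
    rw [integral_const_mul, integral_sub (h.integrable_signedSup h𝓖 hK τ) hΓi, hΓ0, sub_zero]
    exact integral_signedSup_ghostSign_le h h𝓖 hK
  set m := ∫ y, Ξ y ∂(Measure.pi fun _ => ρ) with hmdef
  have hsub := hasSubgaussianMGF_of_boundedDifferences ρ (4 * K / n) hΞm hΞK hΞd
  -- There are `2 * n` coordinates, each contributing `(2 * K / n) ^ 2`.
  have hc : (Fintype.card (Fin n ⊕ Fin n) : ℝ≥0) * ((4 * K / n) / 2) ^ 2 = 8 * K ^ 2 / n := by
    rw [Fintype.card_sum, Fintype.card_fin, Nat.cast_add]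
    have : (n : ℝ≥0) ≠ 0 := by exact_mod_cast hn
    field_simp
    ring
  rw [hc] at hsub
  have mp := measurePreserving_sumElim (ι := Fin n) (ι' := Fin n) ρ
  have hprod := HasSubgaussianMGF.of_map (X := fun y => Ξ y - m) mp.aemeasurable
    (by rw [mp.map_eq]; exact hsub)
  -- The witness `X` is the ghost average of `Ξ - m`. Averaging over the ghosts turns ghost sample
  -- means into population means, for all `f` at once.
  refine ⟨_, hprod.integral_prod_right (K := 4 * K + |m|) fun p =>
    (abs_sub _ _).trans (add_le_add (hΞK _) le_rfl), ?_⟩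
  filter_upwards [(hΞm.comp_quasiMeasurePreserving
    mp.quasiMeasurePreserving).aestronglyMeasurable.prodMk_left] with x hx f hf
  have hfi : Integrable f ρ := integrable_of_abs_le (hm f hf).aemeasurable (hK f hf)
  have havg {u : Z → ℝ} (hu : Integrable u ρ) : Integrable
      (fun x' : Fin n → Z => (1 / n : ℝ) * ∑ i, u (x' i)) (Measure.pi fun _ => ρ) :=
    (integrable_finsetSum _ fun i _ =>
      (measurePreserving_eval (fun _ : Fin n => ρ) i).integrable_comp_fun hu).const_mul _
  have hΞx : Integrable (fun x' => Ξ (Sum.elim x x')) (Measure.pi fun _ => ρ) :=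
    integrable_of_abs_le hx.aemeasurable fun x' => hΞK _
  have hfg : Integrable (fun z => f z - g z) ρ := hfi.sub hgi
  have hle : ∫ x' : Fin n → Z, ((1 / n : ℝ) * ∑ i, (f (x' i) - g (x' i)) +
      ((1 / n : ℝ) * ∑ i, g (x i) - (1 / n : ℝ) * ∑ i, f (x i))) ∂(Measure.pi fun _ => ρ) ≤
      ∫ x', Ξ (Sum.elim x x') ∂(Measure.pi fun _ => ρ) := by
    refine integral_mono ((havg hfg).add (integrable_const _)) hΞx fun x' => ?_
    have := sum_sign_mul_le_signedSup hK τ (Sum.elim x x') hf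
    simp only [Ξ, Γ]
    refine le_trans (le_of_eq ?_) (mul_le_mul_of_nonneg_left (sub_le_sub_right this _)
      (by positivity : (0 : ℝ) ≤ 1 / n))
    simp [Fintype.sum_sum_type, τ, ghostSign]
    ring
  rw [integral_add (havg hfg) (integrable_const _), integral_sample_average hn hfg,
    integral_sub hfi hgi] at hle
  simp only [integral_const, probReal_univ, one_smul] at hle
  simp only [Function.comp_def]
  rw [integral_sub hΞx (integrable_const _)]
  simp only [integral_const, probReal_univ, one_smul]
  linarith

end Symmetrization

/-! ### Averaging over steps and the variance identity -/

section

open scoped NNReal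

variable {Z Ω : Type*} [MeasurableSpace Z] [MeasurableSpace Ω]

/-- For any single `f`, the signed sums for `σ` and `-σ` cancel, so the two suprema have nonnegative
sum. -/
theorem rademacher_nonneg {ρ : Measure Z} {𝓖 : Set (Z → ℝ)} {K : ℝ} (n : ℕ) (h𝓖 : 𝓖.Nonempty)
    (hK : ∀ f ∈ 𝓖, ∀ x, |f x| ≤ K) : 0 ≤ rademacher n ρ 𝓖 := by
  refine integral_nonneg fun x => ?_
  simp only [Pi.zero_apply, empiricalRademacher_eq_sum_signedSup]
  refine mul_nonneg (by positivity) ?_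
  obtain ⟨f, hf⟩ := h𝓖
  have hneg := Equiv.sum_comp (Equiv.neg (Fin n → ℤˣ)) fun σ => signedSup 𝓖 σ x
  have : 0 ≤ ∑ σ : Fin n → ℤˣ, (signedSup 𝓖 (-σ) x + signedSup 𝓖 σ x) :=
    Finset.sum_nonneg fun σ _ => by
      have h1 := sum_sign_mul_le_signedSup hK σ x hf
      have h2 := sum_sign_mul_le_signedSup hK (-σ) x hf
      simp only [Pi.neg_apply, Units.val_neg, Int.cast_neg, neg_mul, Finset.sum_neg_distrib] at h2
      linarith
  rw [Finset.sum_add_distrib] at this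
  simp only [Equiv.neg_apply] at hneg
  linarith

/-- Convexity of `exp` bounds the exponential of the average by the average of the exponentials; no
independence is needed, and the parameter does not grow with `H`. -/
theorem hasSubgaussianMGF_average {P : Measure Ω} [IsProbabilityMeasure P] {H : ℕ} (hH : H ≠ 0)
    {X : Fin H → Ω → ℝ} {c : ℝ≥0} (hX : ∀ h, HasSubgaussianMGF (X h) c P) :
    HasSubgaussianMGF (fun ω => (1 / H : ℝ) * ∑ h, X h ω) c P := by
  have hH' : (0 : ℝ) < H := by positivity
  have hconv (t : ℝ) (ω : Ω) : Real.exp (t * ((1 / H : ℝ) * ∑ h, X h ω)) ≤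
      (1 / H : ℝ) * ∑ h, Real.exp (t * X h ω) := by
    have := convexOn_exp.map_sum_le (t := Finset.univ) (w := fun _ : Fin H => (1 / H : ℝ))
      (p := fun h => t * X h ω) (fun _ _ => by positivity) (by simp [hH]) (by simp)
    simp only [smul_eq_mul, ← Finset.mul_sum] at this
    rwa [mul_left_comm]
  have hint (t : ℝ) : Integrable (fun ω => (1 / H : ℝ) * ∑ h, Real.exp (t * X h ω)) P :=
    (integrable_finsetSum _ fun h _ => (hX h).integrable_exp_mul t).const_mul _
  have hm : AEMeasurable (fun ω => (1 / H : ℝ) * ∑ h, X h ω) P :=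
    (Finset.aemeasurable_fun_sum _ fun h _ => (hX h).aemeasurable).const_mul _
  have hint' (t : ℝ) : Integrable (fun ω => Real.exp (t * ((1 / H : ℝ) * ∑ h, X h ω))) P := by
    refine (hint t).mono' (Real.measurable_exp.comp_aemeasurable
      (hm.const_mul t)).aestronglyMeasurable (ae_of_all _ fun ω => ?_)
    rw [Real.norm_eq_abs, Real.abs_exp]
    exact hconv t ω
  refine ⟨hint', fun t => (integral_mono (hint' t) (hint t) (hconv t)).trans ?_⟩
  rw [integral_const_mul, integral_finsetSum _ fun h _ => (hX h).integrable_exp_mul t,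
    one_div_mul_eq_div, div_le_iff₀ hH']
  calc _ ≤ ∑ _ : Fin H, Real.exp (c * t ^ 2 / 2) := Finset.sum_le_sum fun h _ => (hX h).mgf_le t
    _ = _ := by simp [mul_comm]

theorem integral_sq_sub_half_sq_prod {p : Measure Z} [IsProbabilityMeasure p] {V : Z → ℝ} {K : ℝ}
    (hV : Measurable V) (hK : ∀ s, |V s| ≤ K) (a : ℝ) :
    ∫ s, ((a - V s.1) ^ 2 - 1 / 2 * (V s.1 - V s.2) ^ 2) ∂(p.prod p) = (a - ∫ s, V s ∂p) ^ 2 := by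
  have i₁ : Integrable V p := integrable_of_abs_le hV.aemeasurable hK
  have i₂ : Integrable (fun s => V s ^ 2) p :=
    integrable_of_abs_le (K := K ^ 2) (hV.pow_const 2).aemeasurable fun s => by
      rw [abs_pow]
      exact pow_le_pow_left₀ (abs_nonneg _) (hK s) 2
  have j₁ : Integrable (fun s : Z × Z => -2 * a * V s.1) (p.prod p) :=
    (measurePreserving_fst.integrable_comp_fun i₁).const_mul _
  have j₂ : Integrable (fun s : Z × Z => 1 / 2 * V s.1 ^ 2) (p.prod p) :=
    (measurePreserving_fst.integrable_comp_fun i₂).const_mul _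
  have j₃ : Integrable (fun s : Z × Z => 1 / 2 * V s.2 ^ 2) (p.prod p) :=
    (measurePreserving_snd.integrable_comp_fun i₂).const_mul _
  have j₄ : Integrable (fun s : Z × Z => V s.1 * V s.2) (p.prod p) := i₁.mul_prod i₁
  have j₅ : Integrable (fun s : Z × Z => 1 / 2 * V s.1 ^ 2 - 1 / 2 * V s.2 ^ 2) (p.prod p) :=
    j₂.sub j₃
  have e (s : Z × Z) : (a - V s.1) ^ 2 - 1 / 2 * (V s.1 - V s.2) ^ 2 =
      (a ^ 2 + -2 * a * V s.1) + (1 / 2 * V s.1 ^ 2 - 1 / 2 * V s.2 ^ 2) + V s.1 * V s.2 := by ring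
  have k₁ : ∫ s : Z × Z, V s.1 ∂(p.prod p) = ∫ s, V s ∂p :=
    measurePreserving_fst.integral_comp_of_aemeasurable hV.aemeasurable
  have k₂ : ∫ s : Z × Z, V s.1 ^ 2 ∂(p.prod p) = ∫ s, V s ^ 2 ∂p :=
    measurePreserving_fst.integral_comp_of_aemeasurable i₂.aemeasurable
  have k₃ : ∫ s : Z × Z, V s.2 ^ 2 ∂(p.prod p) = ∫ s, V s ^ 2 ∂p :=
    measurePreserving_snd.integral_comp_of_aemeasurable i₂.aemeasurable
  simp only [e]
  rw [integral_add (((integrable_const _).fun_add j₁).fun_add j₅) j₄,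
    integral_add ((integrable_const _).fun_add j₁) j₅, integral_sub j₂ j₃,
    integral_add (integrable_const _) j₁, integral_prod_mul, integral_const_mul,
    integral_const_mul, integral_const_mul, k₁, k₂, k₃]
  simp only [integral_const, probReal_univ, one_smul]
  ring

end

/-! ### Laws of the data, unbiasedness and complexity of the loss -/

namespace EpisodicMDP

variable {S A : Type*} [MeasurableSpace S] [MeasurableSpace A] {H : ℕ}

section laws

variable (M : EpisodicMDP S A H) (μ : Fin H → Measure (S × A)) [∀ h, IsProbabilityMeasure (μ h)]
  (h : Fin H)

instance : IsProbabilityMeasure (M.nextStateLaw μ h) :=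
  inferInstanceAs (IsProbabilityMeasure (M.transition h ∘ₘ μ h))

instance : IsProbabilityMeasure (M.doubleSampleLaw μ h) :=
  inferInstanceAs (IsProbabilityMeasure (μ h ⊗ₘ (M.transition h ×ₖ M.transition h)))

theorem measurePreserving_stateAction :
    MeasurePreserving (fun z : DoubleSample S A => z.1) (M.doubleSampleLaw μ h) (μ h) :=
  ⟨measurable_fst, Measure.fst_compProd _ _⟩

theorem measurePreserving_nextState :
    MeasurePreserving (fun z : DoubleSample S A => z.2.1) (M.doubleSampleLaw μ h)
      (M.nextStateLaw μ h) := by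
  refine ⟨measurable_fst.comp measurable_snd, ?_⟩
  change Measure.map (Prod.fst ∘ Prod.snd) _ = _
  rw [← Measure.map_map measurable_fst measurable_snd]
  change Measure.map Prod.fst (Measure.snd _) = _
  rw [doubleSampleLaw, Measure.snd_compProd, Measure.map_comp _ _ measurable_fst, ← Kernel.fst_eq,
    Kernel.fst_prod]
  rfl

theorem measurePreserving_ghostNextState :
    MeasurePreserving (fun z : DoubleSample S A => z.2.2) (M.doubleSampleLaw μ h)
      (M.nextStateLaw μ h) := by
  refine ⟨measurable_snd.comp measurable_snd, ?_⟩
  change Measure.map (Prod.snd ∘ Prod.snd) _ = _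
  rw [← Measure.map_map measurable_snd measurable_snd]
  change Measure.map Prod.snd (Measure.snd _) = _
  rw [doubleSampleLaw, Measure.snd_compProd, Measure.map_comp _ _ measurable_snd, ← Kernel.snd_eq,
    Kernel.snd_prod]
  rfl

variable [Fintype A] [Nonempty A]

theorem integral_doubleSampleLoss {g q : S × A → ℝ} (hgm : Measurable g) (hqm : Measurable q)
    (hg : ∀ x, g x ∈ Set.Icc (-(H : ℝ)) H) (hq : ∀ x, q x ∈ Set.Icc (-(H : ℝ)) H) :
    ∫ z, M.doubleSampleLoss h g q z ∂(M.doubleSampleLaw μ h) =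
      ∫ x, (g x - M.bellmanOp h q x) ^ 2 ∂(μ h) := by
  have hint : Integrable (M.doubleSampleLoss h g q) (M.doubleSampleLaw μ h) :=
    integrable_of_abs_le (M.measurable_doubleSampleLoss h hgm hqm).aemeasurable
      (M.abs_doubleSampleLoss_le h hg hq)
  rw [doubleSampleLaw] at hint ⊢
  rw [Measure.integral_compProd hint]
  refine integral_congr_ae (ae_of_all _ fun x => ?_)
  simp only [Kernel.prod_apply, doubleSampleLoss, bellmanOp]
  rw [integral_sq_sub_half_sq_prod (measurable_greedyValue hqm)
    fun s => abs_le.2 (greedyValue_mem_Icc hq s)]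
  ring

/-- Both next states have law `ν_h`, so the coefficients `8` and `2` merge into `10`; the `6` in
front of the other term is enlarged to match. -/
theorem rademacher_doubleSampleLoss_le {n : ℕ} {F Q : Set (S × A → ℝ)} (hF0 : F.Nonempty)
    (hQ0 : Q.Nonempty) (hF : ∀ g ∈ F, ∀ x, g x ∈ Set.Icc (-(H : ℝ)) H)
    (hQ : ∀ q ∈ Q, ∀ x, q x ∈ Set.Icc (-(H : ℝ)) H) (hFm : IsMeasurableClass (μ h) F)
    (hQm : IsMeasurableClass (M.nextStateLaw μ h) (greedyValue '' Q))
    (hℓm : IsMeasurableClass (M.doubleSampleLaw μ h) (Set.image2 (M.doubleSampleLoss h) F Q)) :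
    rademacher n (M.doubleSampleLaw μ h) (Set.image2 (M.doubleSampleLoss h) F Q) ≤
      10 * H * (rademacher n (μ h) F + rademacher n (M.nextStateLaw μ h) (greedyValue '' Q)) := by
  have bF : ∀ g ∈ F, ∀ x, |g x| ≤ H := fun g hg x => abs_le.2 (hF g hg x)
  have bQ : ∀ v ∈ greedyValue '' Q, ∀ s, |v s| ≤ H := by
    rintro _ ⟨q, hq, rfl⟩ s
    exact abs_le.2 (greedyValue_mem_Icc (hQ q hq) s)
  have bℓ : ∀ f ∈ Set.image2 (M.doubleSampleLoss h) F Q, ∀ z, |f z| ≤ 9 * H ^ 2 := by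
    rintro _ ⟨g, hg, q, hq, rfl⟩ z
    exact M.abs_doubleSampleLoss_le h (hF g hg) (hQ q hq) z
  have mp₁ := measurePreserving_pi (fun _ : Fin n => M.doubleSampleLaw μ h) (fun _ => μ h)
    fun _ => M.measurePreserving_stateAction μ h
  have mp₂ := measurePreserving_pi (fun _ : Fin n => M.doubleSampleLaw μ h)
    (fun _ => M.nextStateLaw μ h) fun _ => M.measurePreserving_nextState μ h
  have mp₃ := measurePreserving_pi (fun _ : Fin n => M.doubleSampleLaw μ h)
    (fun _ => M.nextStateLaw μ h) fun _ => M.measurePreserving_ghostNextState μ h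
  have iF := hFm.integrable_empiricalRademacher (n := n) hF0 bF
  have iQ := hQm.integrable_empiricalRademacher (n := n) (hQ0.image _) bQ
  have i₁ := (mp₁.integrable_comp_fun iF).const_mul (6 * (H : ℝ))
  have i₂ := (mp₂.integrable_comp_fun iQ).const_mul (8 * (H : ℝ))
  have i₃ := (mp₃.integrable_comp_fun iQ).const_mul (2 * (H : ℝ))
  have key := integral_mono (hℓm.integrable_empiricalRademacher (n := n) (hF0.image2 hQ0) bℓ)
    ((i₁.fun_add i₂).fun_add i₃) fun z => M.empiricalRademacher_doubleSampleLoss_le h hF0 hQ0 hF hQ z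
  rw [integral_add (i₁.fun_add i₂) i₃, integral_add i₁ i₂, integral_const_mul, integral_const_mul,
    integral_const_mul, mp₁.integral_comp_of_aemeasurable iF.aemeasurable,
    mp₂.integral_comp_of_aemeasurable iQ.aemeasurable,
    mp₃.integral_comp_of_aemeasurable iQ.aemeasurable] at key
  change rademacher n _ _ ≤ 6 * H * rademacher n _ _ + 8 * H * rademacher n _ _ +
    2 * H * rademacher n _ _ at key
  have := mul_nonneg (Nat.cast_nonneg (α := ℝ) H) (rademacher_nonneg (ρ := μ h) n hF0 bF)
  linarith

end laws

end EpisodicMDP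

/-! ### The oracle inequality -/

theorem theorem1 :
    ∃ c : ℝ, 0 < c ∧
      ∀ (S : Type*) (A : Type*) [MeasurableSpace S] [MeasurableSpace A]
        [MeasurableSingletonClass A] [Fintype A] [Nonempty A]
        (H n : ℕ) (_ : 1 ≤ H) (_ : 1 ≤ n)
        (M : EpisodicMDP S A H)
        -- the data distributions over state-action pairs
        (μ : Fin H → Measure (S × A)) (_ : ∀ h, IsProbabilityMeasure (μ h))
        -- the classes `F_1, …, F_H` and `F_{H+1} = {0}`
        (F : Fin (H + 1) → Set (S × A → ℝ))
        (_ : F (Fin.last H) = {0})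
        (_ : ∀ h, ∀ q ∈ F h, Measurable q)
        (_ : ∀ h, ∀ q ∈ F h, ∀ x, q x ∈ Set.Icc (-(H : ℝ)) H)
        -- the suprema over the function and loss classes are random variables
        (_ : ∀ h : Fin H, IsMeasurableClass (μ h) (F h.castSucc))
        (_ : ∀ h : Fin H, IsMeasurableClass (M.nextStateLaw μ h) (greedyValue '' F h.succ))
        (_ : ∀ h : Fin H, IsMeasurableClass (M.doubleSampleLaw μ h)
          (Set.image2 (M.doubleSampleLoss h) (F h.castSucc) (F h.succ)))
        -- the data: at each step, `n` i.i.d. double samples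
        (Ω : Type*) [MeasurableSpace Ω] (P : Measure Ω) (_ : IsProbabilityMeasure P)
        (D : Fin H → Fin n → Ω → DoubleSample S A)
        (_ : ∀ h i, HasLaw (D h i) (M.doubleSampleLaw μ h) P)
        (_ : ∀ h, iIndepFun (D h) P)
        (δ : ℝ) (_ : 0 < δ) (_ : δ < 1),
        -- with probability at least `1 - δ`, every empirical risk minimizer satisfies the bound
        ∃ G : Set Ω, MeasurableSet G ∧ ENNReal.ofReal (1 - δ) ≤ P G ∧
          ∀ ω ∈ G, ∀ fhat ∈ Set.univ.pi F,
            IsMinOn (M.empiricalRisk fun h i => D h i ω) (Set.univ.pi F) fhat →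
            M.bellmanError μ fhat ≤
              sInf (M.bellmanError μ '' Set.univ.pi F)
                + c * (H : ℝ) ^ 2 * √(Real.log (1 / δ) / n)
                + c * ∑ h : Fin H, (rademacher n (μ h) (F h.castSucc)
                    + rademacher n (M.nextStateLaw μ h) (greedyValue '' F h.succ)) := by
  -- `37 = 36 + 1`: `36 * r` is the tail threshold and one more `r` pays for the near-minimizer. The
  -- complexity term needs only `20 = 2 * 10`.
  refine ⟨37, by norm_num, ?_⟩
  intro S A _ _ _ _ _ H n hH hn M μ hμ F _ hFm hFb hFc hVc hℓc Ω _ P hP D hlaw hind δ hδ hδ'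
  have hH0 : H ≠ 0 := by omega
  have hn0 : n ≠ 0 := by omega
  have hH' : (0 : ℝ) < H := by positivity
  have hn' : (0 : ℝ) < n := by positivity
  rcases (Set.univ.pi F).eq_empty_or_nonempty with hempty | hne
  · refine ⟨Set.univ, MeasurableSet.univ, ?_, fun ω _ f hf => by simp [hempty] at hf⟩
    rw [measure_univ]
    exact ENNReal.ofReal_le_one.2 (by linarith)
  have hF0 (h) : (F h).Nonempty := Set.univ_pi_nonempty_iff.1 hne h
  set L := Real.log (1 / δ) with hL
  have hLpos : 0 < L := Real.log_pos (by rw [lt_div_iff₀ hδ]; linarith)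
  set r := (H : ℝ) ^ 2 * √(L / n) with hr
  have hrpos : 0 < r := by positivity
  -- The infimum need not be attained; since `δ < 1` makes `r` positive, a slack of `r` is
  -- available.
  obtain ⟨_, ⟨f₀, hf₀, rfl⟩, hf₀r⟩ := exists_lt_of_csInf_lt (hne.image (M.bellmanError μ))
    (lt_add_of_pos_right (sInf (M.bellmanError μ '' Set.univ.pi F)) hrpos)
  have hmem {f} (hf : f ∈ Set.univ.pi F) (h : Fin (H + 1)) : f h ∈ F h := hf h trivial
  let ℓ (f : Fin (H + 1) → S × A → ℝ) (h : Fin H) := M.doubleSampleLoss h (f h.castSucc) (f h.succ)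
  have hℓ {f} (hf : f ∈ Set.univ.pi F) (h : Fin H) :
      ℓ f h ∈ Set.image2 (M.doubleSampleLoss h) (F h.castSucc) (F h.succ) :=
    Set.mem_image2_of_mem (hmem hf _) (hmem hf _)
  have herr {f} (hf : f ∈ Set.univ.pi F) : M.bellmanError μ f =
      (1 / H : ℝ) * ∑ h, ∫ z, ℓ f h z ∂(M.doubleSampleLaw μ h) := by
    rw [EpisodicMDP.bellmanError]
    congr 1
    refine Finset.sum_congr rfl fun h _ => ?_
    exact (M.integral_doubleSampleLoss μ h (hFm _ _ (hmem hf _)) (hFm _ _ (hmem hf _))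
      (hFb _ _ (hmem hf _)) (hFb _ _ (hmem hf _))).symm
  have hemp (z : Fin H → Fin n → DoubleSample S A) (f : Fin (H + 1) → S × A → ℝ) :
      M.empiricalRisk z f = (1 / H : ℝ) * ∑ h, (1 / n : ℝ) * ∑ i, ℓ f h (z h i) := by
    rw [EpisodicMDP.empiricalRisk, ← Finset.mul_sum, ← mul_assoc]
    congr 1
    field_simp
  choose X hXsub hXdev using fun h : Fin H =>
    (hℓc h).exists_hasSubgaussianMGF_deviation (K := 9 * (H : NNReal) ^ 2) hn0
      (by
        rintro _ ⟨g, hg, q, hq, rfl⟩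
        exact M.measurable_doubleSampleLoss h (hFm _ _ hg) (hFm _ _ hq))
      (by
        rintro _ ⟨g, hg, q, hq, rfl⟩ z
        exact (M.abs_doubleSampleLoss_le h (hFb _ _ hg) (hFb _ _ hq) z).trans_eq (by push_cast; rfl))
      (hℓ hf₀ h)
  have hDm (h : Fin H) : AEMeasurable (fun ω i => D h i ω) P :=
    aemeasurable_pi_lambda _ fun i => (hlaw h i).aemeasurable
  have hDlaw (h : Fin H) : P.map (fun ω i => D h i ω) = Measure.pi fun _ => M.doubleSampleLaw μ h := by
    rw [(iIndepFun_iff_map_fun_eq_pi_map fun i => (hlaw h i).aemeasurable).1 (hind h)]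
    simp only [(hlaw h _).map_eq]
  have hWsub := hasSubgaussianMGF_average hH0 fun h =>
    HasSubgaussianMGF.of_map (hDm h) ((hDlaw h).symm ▸ hXsub h)
  set G : Set Ω :=
    {ω | ∀ h, ∀ f ∈ Set.image2 (M.doubleSampleLoss h) (F h.castSucc) (F h.succ),
      (∫ z, f z ∂(M.doubleSampleLaw μ h) - (1 / n : ℝ) * ∑ i, f (D h i ω)) +
        ((1 / n : ℝ) * ∑ i, ℓ f₀ h (D h i ω) - ∫ z, ℓ f₀ h z ∂(M.doubleSampleLaw μ h)) ≤
      X h (fun i => D h i ω) + 2 * rademacher n (M.doubleSampleLaw μ h)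
        (Set.image2 (M.doubleSampleLoss h) (F h.castSucc) (F h.succ))}
  have hG : P Gᶜ = 0 :=
    mem_ae_iff.1 (ae_all_iff.2 fun h => ae_of_ae_map (hDm h) ((hDlaw h).symm ▸ hXdev h))
  have htail := hWsub.measure_ge_le (ε := 36 * r) (by positivity)
  -- With `K = 9 * H ^ 2` the parameter is `648 * H ^ 4 / n`, and `36 ^ 2 = 2 * 648`, so the tail is
  -- exactly `δ`.
  have hexp : Real.exp (-(36 * r) ^ 2 / (2 * (8 * (9 * (H : NNReal) ^ 2) ^ 2 / n : NNReal))) = δ := by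
    have : -(36 * r) ^ 2 / (2 * (8 * (9 * (H : NNReal) ^ 2) ^ 2 / n : NNReal)) = -L := by
      push_cast
      rw [hr, mul_pow, mul_pow, Real.sq_sqrt (by positivity)]
      field_simp
      norm_num
    rw [this, hL, one_div, Real.log_inv, neg_neg, Real.exp_log hδ]
  rw [hexp] at htail
  set B := {ω | 36 * r ≤ (1 / H : ℝ) * ∑ h, (X h ∘ fun ω i => D h i ω) ω}
  -- The bad set need not be measurable: `G` quantifies over a possibly uncountable class, and `X`
  -- is measurable only almost everywhere.
  set N := toMeasurable P (B ∪ Gᶜ) with hN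
  have hPN : P N ≤ ENNReal.ofReal δ := by
    rw [hN, measure_toMeasurable]
    refine (measure_union_le _ _).trans ?_
    rw [hG, add_zero, ← ofReal_measureReal]
    exact ENNReal.ofReal_le_ofReal htail
  have hNm : MeasurableSet N := measurableSet_toMeasurable _ _
  refine ⟨Nᶜ, hNm.compl, ?_, ?_⟩
  · rw [prob_compl_eq_one_sub hNm, ENNReal.ofReal_sub _ hδ.le, ENNReal.ofReal_one]
    exact tsub_le_tsub_left hPN _
  intro ω hω fhat hfhat hmin
  have hω' : ω ∉ B ∪ Gᶜ := fun h => hω (subset_toMeasurable P _ h)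
  rw [Set.mem_union, not_or, Set.notMem_compl_iff] at hω'
  obtain ⟨hB, hgood⟩ := hω'
  have hB : (1 / H : ℝ) * ∑ h, X h (fun i => D h i ω) < 36 * r := not_le.1 hB
  have hrisk : M.empiricalRisk (fun h i => D h i ω) fhat ≤ M.empiricalRisk (fun h i => D h i ω) f₀ :=
    hmin hf₀
  have hsum := mul_le_mul_of_nonneg_left
    (Finset.sum_le_sum fun h (_ : h ∈ Finset.univ) => hgood h _ (hℓ hfhat h))
    (by positivity : (0 : ℝ) ≤ 1 / H)
  simp only [Finset.sum_add_distrib, Finset.sum_sub_distrib, mul_add, mul_sub] at hsum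
  rw [← herr hfhat, ← herr hf₀, ← hemp (fun h i => D h i ω), ← hemp (fun h i => D h i ω)] at hsum
  have hFR (h : Fin H) : 0 ≤ rademacher n (μ h) (F h.castSucc) :=
    rademacher_nonneg n (hF0 _) fun f hf x => abs_le.2 (hFb _ _ hf x)
  have hVR (h : Fin H) : 0 ≤ rademacher n (M.nextStateLaw μ h) (greedyValue '' F h.succ) := by
    refine rademacher_nonneg (K := H) n ((hF0 _).image _) ?_
    rintro _ ⟨q, hq, rfl⟩ s
    exact abs_le.2 (greedyValue_mem_Icc (hFb _ _ hq) s)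
  have hR : (1 / H : ℝ) * ∑ h : Fin H, 2 * rademacher n (M.doubleSampleLaw μ h)
      (Set.image2 (M.doubleSampleLoss h) (F h.castSucc) (F h.succ)) ≤
      37 * ∑ h : Fin H, (rademacher n (μ h) (F h.castSucc) +
        rademacher n (M.nextStateLaw μ h) (greedyValue '' F h.succ)) := by
    rw [Finset.mul_sum, Finset.mul_sum]
    refine Finset.sum_le_sum fun h _ => ?_
    have := M.rademacher_doubleSampleLoss_le μ h (n := n) (hF0 _) (hF0 _) (hFb _) (hFb _) (hFc h)
      (hVc h) (hℓc h)
    rw [one_div_mul_eq_div, div_le_iff₀ hH']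
    nlinarith [hFR h, hVR h]
  rw [mul_assoc 37, ← hr]
  linarith
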